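/- Let $\mathscr I=(I,\preccurlyeq)$ be a poset such that either $2\le |I|\le 3$, or $\mathscr I$ is the $N$-poset, i.e. the poset $\{1,2,3,4\}$ whose only strict relations are $1\prec 3$, $2\prec 3$ and $2\prec 4$. Then there are infinitely many pairwise non-isomorphic $2$-designs $\mathscr D=(\mathscr P,\mathscr B)$ that admit a block-transitive automorphism group $G$ which is $\mathscr I$-imprimitive on $\mathscr P$. Moreover, the designs can be taken non-trivial and the partitions those of a poset block structure: the block size $k$ satisfies $2<k<|\mathscr P|-1$, the point set is $\mathscr P=\prod_{i\in I}\Delta_i$ with finite sets $\Delta_i$, $|\Delta_i|\ge 2$, and $G$ leaves invariant the partitions $\mathscr C_{A[i]}$ $(i\in I)$ of $\mathscr P$, where two points lie in the same class of $\mathscr C_{A[i]}$ if and only if they agree in all coordinates $j$ with $i\preccurlyeq j$. Here a $2$-design consists of a finite set $\mathscr P$ of points and a set $\mathscr B$ of subsets of $\mathscr P$ (blocks) such that, for some constants $k,r,\lambda>0$, every block has size $k$, every point lies in exactly $r$ blocks, and every pair of distinct points lies in exactly $\lambda$ blocks. An automorphism group is a group of permutations of $\mathscr P$ that preserve $\mathscr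 B$; it is block-transitive if it is transitive on $\mathscr B$. A group $G\le\mathrm{Sym}(\mathscr P)$ is $\mathscr I$-imprimitive on $\mathscr P$ if it is transitive on $\mathscr P$ and leaves invariant every member of a set of partitions of $\mathscr P$ which, ordered by refinement (finer below coarser), is isomorphic to $\mathscr I$. -/

import Mathlib

/-- `𝓑` is the block set of a `t`-`(v, k, lam)` design on the finite point set `P` (with `v = |P|`):
every block has `k > 0` points, every point lies in the same number `r > 0` of blocks, and every
`t`-subset of `P` is contained in exactly `lam > 0` blocks. -/
structure IsDesign {P : Type*} [Fintype P] [DecidableEq P] (𝓑 : Finset (Finset P))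
    (t k lam : ℕ) : Prop where
  k_pos : 0 < k
  lam_pos : 0 < lam
  card_block : ∀ B ∈ 𝓑, B.card = k
  card_point : ∃ r : ℕ, 0 < r ∧ ∀ x : P, (𝓑.filter fun B => x ∈ B).card = r
  card_subset : ∀ S : Finset P, S.card = t → (𝓑.filter fun B => S ⊆ B).card = lam

/-- Two block sets (on possibly different point sets) are isomorphic if some bijection of the
points maps the blocks of the first exactly onto the blocks of the second. -/
def DesignIso {P Q : Type*} (𝓑 : Finset (Finset P)) (𝓑' : Finset (Finset Q)) : Prop :=
  ∃ σ : P ≃ Q, ∀ B : Finset P, B ∈ 𝓑 ↔ B.map σ.toEmbedding ∈ 𝓑'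

/-- Every element of `G` is an automorphism, that is, a permutation of the points which
preserves the block set. -/
def IsAutomorphismGroup {P : Type*} (G : Subgroup (Equiv.Perm P))
    (𝓑 : Finset (Finset P)) : Prop :=
  ∀ g ∈ G, ∀ B : Finset P, B ∈ 𝓑 ↔ B.map g.toEmbedding ∈ 𝓑

/-- Any block can be mapped to any other block by an element of `G`. -/
def IsBlockTransitive {P : Type*} (G : Subgroup (Equiv.Perm P))
    (𝓑 : Finset (Finset P)) : Prop :=
  ∀ B ∈ 𝓑, ∀ B' ∈ 𝓑, ∃ g ∈ G, B.map g.toEmbedding = B'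

/-- `G` is `I`-imprimitive on `P` with respect to the family of partitions `C i`, `i ∈ I`
(partitions being given as equivalence relations): the map `i ↦ C i` is an isomorphism of `I` onto
a set of partitions of `P` ordered by refinement (in Mathlib, `r ≤ s` for setoids means that `r`
refines `s`), `G` is transitive on `P`, and `G` leaves each of the partitions invariant. -/
structure IsImprimitive {I P : Type*} [PartialOrder I] (C : I → Setoid P)
    (G : Subgroup (Equiv.Perm P)) : Prop where
  le_iff : ∀ i j : I, C i ≤ C j ↔ i ≤ j
  transitive : ∀ x y : P, ∃ g ∈ G, g x = y
  invariant : ∀ g ∈ G, ∀ i : I, ∀ x y : P, (C i).r x y ↔ (C i).r (g x) (g y)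

/-- The Cartesian product `∏ i, Δ i` of sets `Δ i` of size `e i`. -/
abbrev Points {I : Type*} (e : I → ℕ) : Type _ := ∀ i : I, Fin (e i)

/-- The partition of `∏ i, Δ i` attached to `i` in the poset block structure of the poset `I`:
two points are in the same class if and only if they agree in all coordinates `j ≥ i`. -/
def ancestralPartition {I : Type*} [PartialOrder I] (e : I → ℕ) (i : I) : Setoid (Points e) where
  r x y := ∀ j : I, i ≤ j → x j = y j
  iseqv :=
    { refl := fun _ _ _ => rfl
      symm := fun h j hj => (h j hj).symm
      trans := fun h h' j hj => (h j hj).trans (h' j hj) }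

/-- `I` is the `N`-poset: it has four elements `a`, `b`, `c`, `d`, and the only strict relations
are `a < c`, `b < c` and `b < d`. -/
def IsNPoset (I : Type*) [PartialOrder I] : Prop :=
  ∃ f : I ≃ Fin 4, ∀ i j : I,
    i ≤ j ↔ f i = f j ∨ (f i = 0 ∧ f j = 2) ∨ (f i = 1 ∧ f j = 2) ∨ (f i = 1 ∧ f j = 3)

/-! The designs are developments of Hadamard difference sets. On `ZMod 4` the function equal to `-1`
only at `0` has vanishing nontrivial autocorrelations, and this survives products (`IsBent.pi`),
giving such an `f` on `A = ∏ i, (ZMod 4)^(n+2)`. The translates of the set `f = 1` form a 2-design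
(`IsBent.isDesign`). The translations of `A` are transitive on points and on blocks. Acting
coordinatewise, they preserve agreement in any set of coordinates, hence every ancestral partition
(`isImprimitive_translationGroup`). Different `n` give different numbers of points. -/

/-- A `±1`-valued function on a finite abelian group of order `s ^ 2` with sum `s`, all of whose
nontrivial autocorrelations vanish. The set where it is `1` is a Hadamard difference set. -/
structure IsBent {A : Type*} [AddCommGroup A] [Fintype A] (f : A → ℤ) (s : ℕ) : Prop where
  values : ∀ x, f x = 1 ∨ f x = -1
  autocorrelation : ∀ d, d ≠ 0 → ∑ x, f x * f (x + d) = 0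
  sum_eq : ∑ x, f x = s
  card_eq : Fintype.card A = s ^ 2

theorem isBent_zmod_four : IsBent (fun x : ZMod 4 => if x = 0 then (-1 : ℤ) else 1) 2 where
  values := by decide
  autocorrelation := by decide
  sum_eq := by decide
  card_eq := by decide

/-- The autocorrelation at `d` factors over the coordinates, and a coordinate with `d i ≠ 0`
contributes a zero factor. -/
theorem IsBent.pi {ι : Type*} [Fintype ι] [DecidableEq ι] {A : Type*} [AddCommGroup A]
    [Fintype A] {f : A → ℤ} {s : ℕ} (hf : IsBent f s) :
    IsBent (fun x : ι → A => ∏ i, f (x i)) (s ^ Fintype.card ι) where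
  values x := by
    refine Finset.prod_induction _ (fun a : ℤ => a = 1 ∨ a = -1) ?_ (Or.inl rfl)
      fun i _ => hf.values (x i)
    rintro a b (rfl | rfl) (rfl | rfl) <;> simp
  autocorrelation d hd := by
    obtain ⟨i, hi⟩ := Function.ne_iff.mp hd
    have h := Finset.prod_univ_sum (fun _ : ι => (Finset.univ : Finset A))
      fun i a => f a * f (a + d i)
    rw [Fintype.piFinset_univ] at h
    simp only [Pi.add_apply, ← Finset.prod_mul_distrib]
    rw [← h]
    exact Finset.prod_eq_zero (Finset.mem_univ i) (hf.autocorrelation _ hi)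
  sum_eq := by
    have h := Finset.prod_univ_sum (fun _ : ι => (Finset.univ : Finset A)) fun _ a => f a
    rw [Fintype.piFinset_univ] at h
    rw [← h, hf.sum_eq]
    simp
  card_eq := by
    rw [Fintype.card_fun, hf.card_eq, ← pow_mul, ← pow_mul, mul_comm]

section Translates

variable {P A : Type*} [AddCommGroup A]

/-- The permutations of `P` which `φ` turns into translations of `A`. -/
def translationGroup (φ : P ≃ A) : Subgroup (Equiv.Perm P) where
  carrier := {g | ∃ t, ∀ x, φ (g x) = φ x + t}
  mul_mem' := by
    rintro g h ⟨t, ht⟩ ⟨u, hu⟩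
    exact ⟨u + t, fun x => by rw [Equiv.Perm.mul_apply, ht, hu, add_assoc]⟩
  one_mem' := ⟨0, fun x => by simp⟩
  inv_mem' := by
    rintro g ⟨t, ht⟩
    exact ⟨-t, fun x => by rw [← sub_eq_add_neg, eq_sub_iff_add_eq, ← ht,
      ← Equiv.Perm.mul_apply, mul_inv_cancel, Equiv.Perm.one_apply]⟩

theorem exists_mem_translationGroup (φ : P ≃ A) (t : A) :
    ∃ g ∈ translationGroup φ, ∀ x, φ (g x) = φ x + t := by
  have h : ∀ x, φ (((φ.trans (Equiv.addRight t)).trans φ.symm) x) = φ x + t := fun x => by simp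
  exact ⟨_, ⟨t, h⟩, h⟩

variable [Fintype P]

/-- The translate by `-t` of the set where `f` is `1`, pulled back to `P`. -/
def translateBlock (φ : P ≃ A) (f : A → ℤ) (t : A) : Finset P :=
  Finset.univ.filter fun x => f (φ x + t) = 1

theorem mem_translateBlock {φ : P ≃ A} {f : A → ℤ} {t : A} {x : P} :
    x ∈ translateBlock φ f t ↔ f (φ x + t) = 1 := by
  simp [translateBlock]

theorem map_translateBlock {φ : P ≃ A} (f : A → ℤ) {g : Equiv.Perm P} {u : A}
    (hg : ∀ x, φ (g x) = φ x + u) (t : A) :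
    (translateBlock φ f t).map g.toEmbedding = translateBlock φ f (t - u) := by
  ext x
  obtain ⟨y, rfl⟩ := g.surjective x
  rw [Finset.mem_map_equiv, Equiv.symm_apply_apply, mem_translateBlock, mem_translateBlock, hg,
    add_add_sub_cancel]

variable [Fintype A]

section

variable {f : A → ℤ} {s : ℕ}

theorem IsBent.autocorrelation_translate (hf : IsBent f s) {a b : A} (hab : a ≠ b) :
    ∑ t, f (a + t) * f (b + t) = 0 := by
  rw [← hf.autocorrelation (b - a) (sub_ne_zero.mpr hab.symm)]
  refine Fintype.sum_equiv (Equiv.addLeft a) _ _ fun t => ?_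
  rw [Equiv.coe_addLeft, show a + t + (b - a) = b + t by abel]

/-- The indicator of `f = 1` is `(1 + f) / 2`; summing it gives the count. For pairs, the product of
two such indicators is summed, and the cross term is an autocorrelation. -/
theorem IsBent.two_mul_card_filter (hf : IsBent f s) (a : A) :
    2 * (Finset.univ.filter fun t => f (a + t) = 1).card = s ^ 2 + s := by
  have hsum : ∑ t, f (a + t) = s := (Equiv.sum_comp (Equiv.addLeft a) f).trans hf.sum_eq
  have h : ∀ t, (2 : ℤ) * (if f (a + t) = 1 then 1 else 0) = 1 + f (a + t) := fun t => by
    rcases hf.values (a + t) with h | h <;> simp [h]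
  zify
  rw [Finset.card_filter]
  push_cast
  rw [Finset.mul_sum, Finset.sum_congr rfl fun t _ => h t, Finset.sum_add_distrib, hsum]
  simp [hf.card_eq]

theorem IsBent.four_mul_card_filter (hf : IsBent f s) {a b : A} (hab : a ≠ b) :
    4 * (Finset.univ.filter fun t => f (a + t) = 1 ∧ f (b + t) = 1).card = s ^ 2 + 2 * s := by
  have hsum : ∀ a, ∑ t, f (a + t) = s := fun a =>
    (Equiv.sum_comp (Equiv.addLeft a) f).trans hf.sum_eq
  have h : ∀ t, (4 : ℤ) * (if f (a + t) = 1 ∧ f (b + t) = 1 then 1 else 0) =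
      1 + f (a + t) + f (b + t) + f (a + t) * f (b + t) := fun t => by
    rcases hf.values (a + t) with h | h <;> rcases hf.values (b + t) with h' | h' <;>
      simp [h, h']
  zify
  rw [Finset.card_filter]
  push_cast
  rw [Finset.mul_sum, Finset.sum_congr rfl fun t _ => h t, Finset.sum_add_distrib,
    Finset.sum_add_distrib, Finset.sum_add_distrib, hsum, hsum, hf.autocorrelation_translate hab]
  simp [hf.card_eq]
  ring

/-- Equal blocks for `t ≠ u` would make a nontrivial autocorrelation equal to `s ^ 2 > 0`. Hence
counting blocks amounts to counting translations. -/
theorem IsBent.translateBlock_injective (hf : IsBent f s) (hs : 0 < s) (φ : P ≃ A) :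
    Function.Injective (translateBlock φ f) := by
  intro t u htu
  by_contra hne
  have hval : ∀ x, f (t + x) * f (u + x) = 1 := fun x => by
    have h := Finset.ext_iff.mp htu (φ.symm x)
    rw [mem_translateBlock, mem_translateBlock, Equiv.apply_symm_apply, add_comm x t,
      add_comm x u] at h
    rcases hf.values (t + x) with h₁ | h₁ <;> rcases hf.values (u + x) with h₂ | h₂ <;>
      simp_all
  have h := hf.autocorrelation_translate hne
  simp [hval, hf.card_eq, hs.ne'] at h

end

variable [DecidableEq P]

/-- The development of the set where `f` is `1`. -/
def translateBlocks (φ : P ≃ A) (f : A → ℤ) : Finset (Finset P) :=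
  Finset.univ.image (translateBlock φ f)

theorem isAutomorphismGroup_translationGroup (φ : P ≃ A) (f : A → ℤ) :
    IsAutomorphismGroup (translationGroup φ) (translateBlocks φ f) := by
  rintro g ⟨u, hu⟩ B
  simp only [translateBlocks, Finset.mem_image, Finset.mem_univ, true_and]
  constructor
  · rintro ⟨t, rfl⟩
    exact ⟨t - u, (map_translateBlock f hu t).symm⟩
  · rintro ⟨t, ht⟩
    refine ⟨t + u, Finset.map_injective g.toEmbedding ?_⟩
    rw [map_translateBlock f hu, add_sub_cancel_right, ht]

theorem isBlockTransitive_translationGroup (φ : P ≃ A) (f : A → ℤ) :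
    IsBlockTransitive (translationGroup φ) (translateBlocks φ f) := by
  intro B hB B' hB'
  simp only [translateBlocks, Finset.mem_image, Finset.mem_univ, true_and] at hB hB'
  obtain ⟨t, rfl⟩ := hB
  obtain ⟨t', rfl⟩ := hB'
  obtain ⟨g, hg, hgt⟩ := exists_mem_translationGroup φ (t - t')
  exact ⟨g, hg, by rw [map_translateBlock f hgt, sub_sub_cancel]⟩

variable {f : A → ℤ} {s : ℕ}

theorem IsBent.card_filter_translateBlocks (hf : IsBent f s) (hs : 0 < s) (φ : P ≃ A)
    (S : Finset P) :
    ((translateBlocks φ f).filter fun B => S ⊆ B).card =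
      (Finset.univ.filter fun t => ∀ x ∈ S, f (φ x + t) = 1).card := by
  rw [translateBlocks, Finset.filter_image,
    Finset.card_image_of_injective _ (hf.translateBlock_injective hs φ)]
  simp only [Finset.subset_iff, mem_translateBlock]

theorem IsBent.isDesign (hf : IsBent f s) (hs : 0 < s) (φ : P ≃ A) {k lam : ℕ}
    (hk : 2 * k = s ^ 2 + s) (hlam : 4 * lam = s ^ 2 + 2 * s) :
    IsDesign (translateBlocks φ f) 2 k lam where
  k_pos := by
    have : 0 < s ^ 2 + s := by positivity
    omega
  lam_pos := by
    have : 0 < s ^ 2 + 2 * s := by positivity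
    omega
  card_block B hB := by
    simp only [translateBlocks, Finset.mem_image, Finset.mem_univ, true_and] at hB
    obtain ⟨t, rfl⟩ := hB
    have h : (translateBlock φ f t).map φ.toEmbedding =
        Finset.univ.filter fun x => f (t + x) = 1 := by
      ext x
      rw [Finset.mem_map_equiv, mem_translateBlock, Equiv.apply_symm_apply, add_comm]
      simp
    have h' := hf.two_mul_card_filter t
    rw [← h, Finset.card_map] at h'
    omega
  card_point := by
    refine ⟨k, ?_, fun x => ?_⟩
    · have : 0 < s ^ 2 + s := by positivity
      omega
    · have h := hf.card_filter_translateBlocks hs φ {x}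
      simp only [Finset.singleton_subset_iff, Finset.mem_singleton, forall_eq] at h
      have h' := hf.two_mul_card_filter (φ x)
      omega
  card_subset S hS := by
    obtain ⟨x, y, hxy, rfl⟩ := Finset.card_eq_two.mp hS
    have h := hf.four_mul_card_filter (φ.injective.ne hxy)
    rw [hf.card_filter_translateBlocks hs φ]
    simp only [Finset.mem_insert, Finset.mem_singleton, forall_eq_or_imp, forall_eq]
    omega

end Translates

theorem ancestralPartition_le_iff {I : Type*} [PartialOrder I] [DecidableEq I] {e : I → ℕ}
    (he : ∀ i, 2 ≤ e i) (i j : I) :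
    ancestralPartition e i ≤ ancestralPartition e j ↔ i ≤ j := by
  refine ⟨fun h => ?_, fun hij x y hxy l hl => hxy l (hij.trans hl)⟩
  by_contra hij
  let x : Points e := fun l => ⟨0, by have := he l; omega⟩
  -- Changing only coordinate `j` is invisible to the partition at `i` when `i ≤ j` fails.
  let y : Points e := Function.update x j ⟨1, he j⟩
  have hxy : (ancestralPartition e i).r x y := fun l hl =>
    (Function.update_of_ne (by rintro rfl; exact hij hl) _ _).symm
  have hj : x j = y j := h hxy j le_rfl
  simp [x, y] at hj

theorem isImprimitive_translationGroup {I : Type*} [PartialOrder I] [DecidableEq I] {e : I → ℕ}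
    (he : ∀ i, 2 ≤ e i) {A : I → Type*} [∀ i, AddCommGroup (A i)] (ψ : ∀ i, Fin (e i) ≃ A i) :
    IsImprimitive (ancestralPartition e) (translationGroup (Equiv.piCongrRight ψ)) where
  le_iff := ancestralPartition_le_iff he
  transitive x y := by
    obtain ⟨g, hg, hgt⟩ := exists_mem_translationGroup (Equiv.piCongrRight ψ)
      (Equiv.piCongrRight ψ y - Equiv.piCongrRight ψ x)
    exact ⟨g, hg, (Equiv.piCongrRight ψ).injective (by rw [hgt, add_sub_cancel])⟩
  invariant := by
    rintro g ⟨t, ht⟩ i x y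
    have h : ∀ z j, ψ j (g z j) = ψ j (z j) + t j := fun z j => congrFun (ht z) j
    refine forall₂_congr fun j _ => ?_
    rw [← (ψ j).apply_eq_iff_eq (x := g x j), h, h, add_left_inj, (ψ j).apply_eq_iff_eq]

theorem DesignIso.card_eq {P Q : Type*} [Fintype P] [Fintype Q] {𝓑 : Finset (Finset P)}
    {𝓑' : Finset (Finset Q)} (h : DesignIso 𝓑 𝓑') : Fintype.card P = Fintype.card Q :=
  h.elim fun σ _ => Fintype.card_congr σ

theorem theorem1p2 {I : Type*} [Fintype I] [DecidableEq I] [PartialOrder I]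
    (hI : (2 ≤ Fintype.card I ∧ Fintype.card I ≤ 3) ∨ IsNPoset I) :
    ∃ (e : ℕ → I → ℕ) (𝓑 : ∀ n : ℕ, Finset (Finset (Points (e n)))),
      (∀ m n : ℕ, m ≠ n → ¬ DesignIso (𝓑 m) (𝓑 n)) ∧
      ∀ n : ℕ,
        (∀ i : I, 2 ≤ e n i) ∧
        (∃ k lam : ℕ, 2 < k ∧ k + 1 < Fintype.card (Points (e n)) ∧ IsDesign (𝓑 n) 2 k lam) ∧
        ∃ G : Subgroup (Equiv.Perm (Points (e n))),
          IsAutomorphismGroup G (𝓑 n) ∧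
          IsBlockTransitive G (𝓑 n) ∧
          IsImprimitive (ancestralPartition (e n)) G := by
  have hcard : Fintype.card I ≠ 0 := by
    rcases hI with h | ⟨f, -⟩
    · omega
    · simp [Fintype.card_congr f]
  let ψ (n : ℕ) : Fin (4 ^ (n + 2)) ≃ (Fin (n + 2) → ZMod 4) := finFunctionFinEquiv.symm
  let φ (n : ℕ) : Points (fun _ : I => 4 ^ (n + 2)) ≃ (I → Fin (n + 2) → ZMod 4) :=
    Equiv.piCongrRight fun _ => ψ n
  let f (n : ℕ) (x : I → Fin (n + 2) → ZMod 4) : ℤ :=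
    ∏ i, ∏ j, if x i j = 0 then (-1 : ℤ) else 1
  have hf (n : ℕ) : IsBent (f n) ((2 ^ (n + 2)) ^ Fintype.card I) := by
    simpa using (isBent_zmod_four.pi (ι := Fin (n + 2))).pi (ι := I)
  have he (n : ℕ) (_ : I) : 2 ≤ 4 ^ (n + 2) :=
    (by norm_num : 2 ≤ 4 ^ 1).trans (Nat.pow_le_pow_right (by norm_num) (by omega))
  refine ⟨fun n _ => 4 ^ (n + 2), fun n => translateBlocks (φ n) (f n), fun m n hmn h => hmn ?_,
    fun n => ⟨he n, ?_, translationGroup (φ n), isAutomorphismGroup_translationGroup _ _,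
      isBlockTransitive_translationGroup _ _, isImprimitive_translationGroup (he n) fun _ => ψ n⟩⟩
  · have h' := h.card_eq
    simp only [Fintype.card_pi, Fintype.card_fin, Finset.prod_const, Finset.card_univ] at h'
    have h'' := Nat.pow_right_injective (by norm_num) (Nat.pow_left_injective hcard h')
    omega
  -- With `s = 4 * c`, the parameters `k = (s ^ 2 + s) / 2` and `lam = (s ^ 2 + 2 * s) / 4` become
  -- polynomials in `c`, and `v = 16 * c ^ 2`.
  · obtain ⟨c, hc, hc₀⟩ : ∃ c, (2 ^ (n + 2)) ^ Fintype.card I = 4 * c ∧ 0 < c := by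
      obtain ⟨c, hc⟩ : 4 ∣ (2 ^ (n + 2)) ^ Fintype.card I :=
        (Dvd.intro_left (2 ^ n) (by rw [pow_add]; rfl)).trans (dvd_pow_self _ hcard)
      exact ⟨c, hc, Nat.pos_of_ne_zero fun h => by simp [h] at hc⟩
    have hfc := hf n
    rw [hc] at hfc
    refine ⟨8 * c ^ 2 + 2 * c, 4 * c ^ 2 + 2 * c, by nlinarith, ?_,
      hfc.isDesign (by positivity) (φ n) (by ring) (by ring)⟩
    rw [Fintype.card_congr (φ n), hfc.card_eq]
    nlinarith
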